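/- Let $n\ge 1$ and let $A=(a_{i,j})\in\mathbb R^{n\times n}$ be an irreducible L-matrix (that is, $a_{i,j}\le 0$ for $i\ne j$, $a_{i,i}>0$, and $A$ is not reducible) with $a_{i,i}=1$ for all $i$. Let $0<\omega\le 1$ and $0\le\gamma\le 1$. For a square matrix $B=D-L-U$, with $D$ diagonal, $L$ strictly lower and $U$ strictly upper triangular, let $$\mathscr L_{\gamma,\omega}(B)=(D-\gamma L)^{-1}\left[(1-\omega)D+(\omega-\gamma)L+\omega U\right]$$ be its AOR iteration matrix, and let $\rho$ denote the spectral radius. Let $\alpha_{i,j}\ge 0$ for $1\le i<j\le n$ with $\sum_{i=1}^{n-1}\sum_{j=i+1}^{n}\alpha_{i,j}a_{i,j}\ne 0$, let $Q_{12}$ be the strictly upper triangular matrix with entries $-\alpha_{i,j}a_{i,j}$ for $j>i$ and $0$ otherwise, and let $A^{(12)}=(I+Q_{12})A$. Write $\mathscr L_{\gamma,\omega}=\mathscr L_{\gamma,\omega}(A)$ and $\mathscr L^{(12)}_{\gamma,\omega}=\mathscr L_{\gamma,\omega}(A^{(12)})$, and for $j>i$ put $$e_{i,j}=(1-\alpha_{i,j})a_{i,j}-\sum_{k=i+1,\;k\ne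 j}^{n}\alpha_{i,k}a_{i,k}a_{k,j}.$$ Consider the two conditions (W) $e_{i,j}\le 0$ for all $1\le i\le n-1$, $j>i$; (S) for all $1\le i\le n-1$, $j>i$ with $a_{i,j}<0$: $e_{i,j}\le 0$, where equality is allowed only if $A^{(12)}$ is irreducible (so $e_{i,j}<0$ if $A^{(12)}$ is reducible). Suppose that $\sum_{k=i+1}^{n}\alpha_{i,k}a_{i,k}a_{k,i}<1$ for $i=1,\dots,n-1$, and that one of the following holds: (i) $0\le\gamma<1$ and (S) holds. (ii) $\gamma=1$, (S) holds, and one of the following holds: (ii$_1$) there exist $i\in\{1,\dots,n-1\}$, $j\in\{1,\dots,i\}$, $k\in\{i+1,\dots,n\}$ with $\alpha_{i,k}a_{i,k}a_{k,j}>0$; (ii$_2$) there exist $i\in\{1,\dots,n-1\}$, $j\in\{i+2,\dots,n\}$, $k\in\{i+1,\dots,j-1\}$ with $\alpha_{i,k}a_{i,k}a_{k,j}>0$; (ii$_3$) there exists $k\in\{1,\dots,n-1\}$ with $a_{k,k+1}<0$ and $\alpha_{k,k+1}>0$; (ii$_4$) $a_{n,1}<0$ and $a_{k,k+1}<0$ for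 $k=1,\dots,n-1$; (ii$_5$) $a_{n,1}<0$ and $a_{k,n}<0$ for $k=2,\dots,n-1$; (ii$_6$) $a_{k,1}<0$ for $k=2,\dots,n$. (iii) $0\le\gamma<1$, (W) holds, and for each $i\in\{1,\dots,n-1\}$ there exists $j\in\{i+1,\dots,n\}$ with $\alpha_{i,j}a_{i,j}<0$. (iv) $\gamma=1$, (W) holds, and for each $i\in\{1,\dots,n-1\}$ one of the following holds: (iv$_1$) there exist $j\in\{1,\dots,i\}$, $k\in\{i+1,\dots,n\}$ with $\alpha_{i,k}a_{i,k}a_{k,j}>0$; (iv$_2$) there exist $j\in\{i+2,\dots,n\}$, $k\in\{i+1,\dots,j-1\}$ with $\alpha_{i,k}a_{i,k}a_{k,j}>0$; (iv$_3$) $a_{i,i+1}<0$ and $\alpha_{i,i+1}>0$. Then exactly one of the following mutually exclusive relations holds: (a) $\rho(\mathscr L^{(12)}_{\gamma,\omega})<\rho(\mathscr L_{\gamma,\omega})<1$; (b) $\rho(\mathscr L^{(12)}_{\gamma,\omega})=\rho(\mathscr L_{\gamma,\omega})=1$; (c) $\rho(\mathscr L^{(12)}_{\gamma,\omega})>\rho(\mathscr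 L_{\gamma,\omega})>1$. -/

import Mathlib

open scoped ENNReal

namespace PrecondAOR

/-- Z-matrix: all off-diagonal entries are nonpositive. -/
def IsZMatrix {n : ℕ} (B : Matrix (Fin n) (Fin n) ℝ) : Prop :=
  ∀ i j, i ≠ j → B i j ≤ 0

/-- L-matrix: a Z-matrix with positive diagonal entries. -/
def IsLMatrix {n : ℕ} (B : Matrix (Fin n) (Fin n) ℝ) : Prop :=
  IsZMatrix B ∧ ∀ i, 0 < B i i

/-- `B` is reducible: after a simultaneous permutation of rows and columns it has the block form
`[[B₁₁, B₁₂], [0, B₂₂]]` with `B₁₁` of size `r × r`, `1 ≤ r ≤ n - 1`. -/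
def IsReducible {n : ℕ} (B : Matrix (Fin n) (Fin n) ℝ) : Prop :=
  ∃ (σ : Equiv.Perm (Fin n)) (r : ℕ), 1 ≤ r ∧ r < n ∧
    ∀ i j : Fin n, r ≤ (i : ℕ) → (j : ℕ) < r → B.submatrix σ σ i j = 0

def IsIrreducible {n : ℕ} (B : Matrix (Fin n) (Fin n) ℝ) : Prop :=
  ¬ IsReducible B

/-- The matrices `D`, `L`, `U` of the decomposition `B = D - L - U`
(diagonal, strictly lower triangular, strictly upper triangular). -/
def diagPart {n : ℕ} (B : Matrix (Fin n) (Fin n) ℝ) : Matrix (Fin n) (Fin n) ℝ :=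
  Matrix.diagonal fun i => B i i

def lowerPart {n : ℕ} (B : Matrix (Fin n) (Fin n) ℝ) : Matrix (Fin n) (Fin n) ℝ :=
  Matrix.of fun i j => if j < i then -B i j else 0

def upperPart {n : ℕ} (B : Matrix (Fin n) (Fin n) ℝ) : Matrix (Fin n) (Fin n) ℝ :=
  Matrix.of fun i j => if i < j then -B i j else 0

/-- The AOR iteration matrix
`(D - γ L)⁻¹ [(1 - ω) D + (ω - γ) L + ω U]` of `B = D - L - U`. -/
noncomputable def aorMatrix {n : ℕ} (B : Matrix (Fin n) (Fin n) ℝ) (γ ω : ℝ) :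
    Matrix (Fin n) (Fin n) ℝ :=
  (diagPart B - γ • lowerPart B)⁻¹ *
    ((1 - ω) • diagPart B + (ω - γ) • lowerPart B + ω • upperPart B)

/-- The spectral radius of a real matrix: the largest modulus of its complex eigenvalues. -/
noncomputable def specRadius {n : ℕ} (B : Matrix (Fin n) (Fin n) ℝ) : ℝ≥0∞ :=
  spectralRadius ℂ (B.map Complex.ofReal)

/-- The strictly upper triangular matrix with entries `-α i j * A i j` for `i < j`. -/
def upperQ {n : ℕ} (A : Matrix (Fin n) (Fin n) ℝ) (α : Fin n → Fin n → ℝ) :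
    Matrix (Fin n) (Fin n) ℝ :=
  Matrix.of fun i j => if i < j then -(α i j * A i j) else 0

/-- The preconditioned matrix `(I + Q) A`. -/
def precondMatrix {n : ℕ} (A : Matrix (Fin n) (Fin n) ℝ) (α : Fin n → Fin n → ℝ) :
    Matrix (Fin n) (Fin n) ℝ :=
  (1 + upperQ A α) * A

/-- The expression `(1 - α_{ij}) a_{ij} - ∑_{k > i, k ≠ j} α_{ik} a_{ik} a_{kj}`. -/
def upperExpr {n : ℕ} (A : Matrix (Fin n) (Fin n) ℝ) (α : Fin n → Fin n → ℝ)
    (i j : Fin n) : ℝ :=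
  (1 - α i j) * A i j - ∑ k ∈ (Finset.Ioi i).erase j, α i k * A i k * A k j

/-- The weak sign condition: the expression is `≤ 0` for all `i < j`. -/
def WeakCond {n : ℕ} (A : Matrix (Fin n) (Fin n) ℝ) (α : Fin n → Fin n → ℝ) : Prop :=
  ∀ i j : Fin n, i < j → upperExpr A α i j ≤ 0

/-- The relation `t ≲ 0` relative to a matrix `B`: `t ≤ 0`,
where equality is allowed only if `B` is irreducible. -/
def LesssimZero {n : ℕ} (B : Matrix (Fin n) (Fin n) ℝ) (t : ℝ) : Prop :=
  t < 0 ∨ (t = 0 ∧ IsIrreducible B)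

/-- The sign condition: the expression is `≲ 0` for all `i < j` with `a_{ij} < 0`. -/
def LesssimCond {n : ℕ} (A : Matrix (Fin n) (Fin n) ℝ) (α : Fin n → Fin n → ℝ) : Prop :=
  ∀ i j : Fin n, i < j → A i j < 0 → LesssimZero (precondMatrix A α) (upperExpr A α i j)

/-- Exactly one of the three relations of the strict Stein-Rosenberg trichotomy holds
between the spectral radii `r'` (preconditioned) and `r` (original). -/
def StrictTrichotomy (r' r : ℝ≥0∞) : Prop :=
  ((r' < r ∧ r < 1) ∨ (r' = r ∧ r = 1) ∨ (r' > r ∧ r > 1)) ∧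
    ¬ ((r' < r ∧ r < 1) ∧ (r' = r ∧ r = 1)) ∧
    ¬ ((r' < r ∧ r < 1) ∧ (r' > r ∧ r > 1)) ∧
    ¬ ((r' = r ∧ r = 1) ∧ (r' > r ∧ r > 1))

end PrecondAOR

/-! Split `B = M - N` with `M = D - γL` and `N = (1 - γ)L + U`. For an L-matrix, `M⁻¹` and `N` are
nonnegative, and the AOR matrix is `(1 - ω)I + ω M⁻¹N`, so its spectral radius is `1 - ω + ωρ` with
`ρ` the Perron root of `M⁻¹N`. Since `t ↦ 1 - ω + ωt` is increasing and fixes 1, it suffices to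
compare the roots `ρ` of `A` and `ρ'` of `A' = (I + Q)A`.

Take a right Perron vector, `N x = ρ M x`, and a left one, `v N' = ρ' v M'`. Evaluating `v A' x` in
two ways (`comparison_identity`) gives `(ρ' - ρ) (v M' x) = (ρ - 1) (v · z)` with `z = ((I + Q)M -
M')x`. Irreducibility of `A` makes `ρ` and `x` positive, whence `v M' x > 0`; moreover `z ≥ 0`
because `M x = ρ⁻¹ N x ≥ 0` and `M' ≤ M`. Once `v · z > 0`, the sign of `ρ' - ρ` is that of `ρ - 1`.

Strictness is needed only when `ρ' > 0`, and comes in two ways. Under (S), `A'` is irreducible, so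
`v` is positive and one positive entry of `z` is enough. Under (W), `z` is positive at every index
but possibly the last, and `v` cannot be supported on the last index alone. -/

namespace PrecondAOR

open Matrix Filter Topology

/-! ### Weak Perron–Frobenius theory by the Collatz–Wielandt method. -/

section Perron

variable {ι : Type*} [Fintype ι]

/-- Collatz–Wielandt: an entrywise positive matrix has a nonnegative eigenvector, normalized in the
standard simplex, whose eigenvalue bounds every `s` with `s • w ≤ T *ᵥ w` for some `w ≥ 0`. -/
theorem exists_perron_of_pos [Nonempty ι] (T : Matrix ι ι ℝ) (hT : ∀ i j, 0 < T i j) :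
    ∃ r : ℝ, 0 ≤ r ∧ r ≤ ∑ i, ∑ j, T i j ∧ ∃ x ∈ stdSimplex ℝ ι, T *ᵥ x = r • x ∧
      ∀ (s : ℝ) (w : ι → ℝ), 0 ≤ w → w ≠ 0 → s • w ≤ T *ᵥ w → s ≤ r := by
  classical
  set C : ℝ := ∑ i, ∑ j, T i j with hC
  have hC0 : 0 ≤ C := Finset.sum_nonneg fun i _ => Finset.sum_nonneg fun j _ => (hT i j).le
  have hcontT : Continuous fun p : ℝ × (ι → ℝ) => T *ᵥ p.2 :=
    (Continuous.matrix_mulVec continuous_const continuous_snd)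
  -- Pairs of a value `s` and a normalized vector `w` with `s w ≤ T w`; compactness yields a pair
  -- with largest `s`.
  let K : Set (ℝ × (ι → ℝ)) :=
    (Set.Icc 0 C ×ˢ stdSimplex ℝ ι) ∩ {p | p.1 • p.2 ≤ T *ᵥ p.2}
  have hK : IsCompact K := by
    refine (isCompact_Icc.prod (isCompact_stdSimplex ℝ ι)).inter_right ?_
    exact isClosed_le (continuous_fst.smul continuous_snd) hcontT
  have hTnn : ∀ w : ι → ℝ, 0 ≤ w → 0 ≤ T *ᵥ w := fun w hw i =>
    Finset.sum_nonneg fun j _ => mul_nonneg (hT i j).le (hw j)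
  have hKne : K.Nonempty := by
    obtain ⟨i⟩ := ‹Nonempty ι›
    refine ⟨(0, Pi.single i 1), ⟨⟨⟨le_rfl, hC0⟩, single_mem_stdSimplex ℝ i⟩, ?_⟩⟩
    have := hTnn (Pi.single i 1) (single_mem_stdSimplex ℝ i).1
    simpa using this
  obtain ⟨⟨r, x⟩, ⟨⟨⟨hr0, hrC⟩, hx⟩, hrx⟩, hmax⟩ :=
    hK.exists_isMaxOn hKne continuous_fst.continuousOn
  simp only at hr0 hrC hx
  have hrx : r • x ≤ T *ᵥ x := hrx
  have hbd : ∀ (s : ℝ) (w : ι → ℝ), 0 ≤ w → w ≠ 0 → s • w ≤ T *ᵥ w → s ≤ r := by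
    intro s w hw hw0 hsw
    by_contra! hs
    have hs0 : 0 ≤ s := hr0.trans hs.le
    have hW : 0 < ∑ i, w i := by
      refine lt_of_le_of_ne (Finset.sum_nonneg fun i _ => hw i) fun h => hw0 ?_
      funext i
      exact (Finset.sum_eq_zero_iff_of_nonneg fun i _ => hw i).1 h.symm i (Finset.mem_univ i)
    have hsC : s ≤ C := by
      have h1 : s * ∑ i, w i ≤ C * ∑ i, w i := by
        rw [Finset.mul_sum, hC, Finset.sum_mul]
        refine Finset.sum_le_sum fun i _ => (hsw i).trans ?_
        change ∑ j, T i j * w j ≤ _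
        rw [Finset.sum_mul]
        exact Finset.sum_le_sum fun j _ => mul_le_mul_of_nonneg_left
          (Finset.single_le_sum (fun k _ => hw k) (Finset.mem_univ j)) (hT i j).le
      exact le_of_mul_le_mul_right h1 hW
    have hmem : (s, (∑ i, w i)⁻¹ • w) ∈ K := by
      refine ⟨⟨⟨hs0, hsC⟩, ?_, ?_⟩, ?_⟩
      · intro i; exact mul_nonneg (inv_nonneg.2 hW.le) (hw i)
      · simp only [Pi.smul_apply, smul_eq_mul, ← Finset.mul_sum]
        exact inv_mul_cancel₀ hW.ne'
      · change s • ((∑ i, w i)⁻¹ • w) ≤ T *ᵥ ((∑ i, w i)⁻¹ • w)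
        rw [mulVec_smul, smul_comm]
        exact smul_le_smul_of_nonneg_left hsw (inv_nonneg.2 hW.le)
    exact absurd (hmax hmem) (not_le.2 hs)
  refine ⟨r, hr0, hrC, x, hx, ?_, hbd⟩
  -- If `T x - r x` is nonnegative and nonzero, applying `T` makes it strictly positive, so `T x` is
  -- a test vector for some `r + δ` with `δ > 0`, contradicting maximality.
  by_contra hne
  have hpos : ∀ u : ι → ℝ, 0 ≤ u → u ≠ 0 → ∀ i, 0 < (T *ᵥ u) i := by
    intro u hu hu0 i
    obtain ⟨j, hj⟩ := Function.ne_iff.1 hu0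
    exact Finset.sum_pos' (fun k _ => mul_nonneg (hT i k).le (hu k))
      ⟨j, Finset.mem_univ j, mul_pos (hT i j) (lt_of_le_of_ne (hu j) (Ne.symm hj))⟩
  have hx0 : x ≠ 0 := by
    rintro rfl
    simpa using hx.2
  have hw := hpos x hx.1 hx0
  have hu := hpos (T *ᵥ x - r • x) (sub_nonneg.2 hrx) (sub_ne_zero.2 hne)
  have hev : ∀ᶠ δ : ℝ in 𝓝[>] 0, ∀ i, δ * (T *ᵥ x) i < (T *ᵥ (T *ᵥ x - r • x)) i := by
    refine eventually_all.2 fun i => ?_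
    have ht : Tendsto (fun δ : ℝ => δ * (T *ᵥ x) i) (𝓝[>] 0) (𝓝 (0 * (T *ᵥ x) i)) :=
      (tendsto_id.mul_const _).mono_left nhdsWithin_le_nhds
    rw [zero_mul] at ht
    exact ht.eventually_lt_const (hu i)
  obtain ⟨δ, hδ, hδ0⟩ := (hev.and self_mem_nhdsWithin).exists
  have hδ0 : 0 < δ := hδ0
  have hle := hbd (r + δ) (T *ᵥ x) (fun i => (hw i).le)
    (fun h => by
      obtain ⟨i⟩ := ‹Nonempty ι›
      exact (hw i).ne' (congrFun h i))
    (fun i => by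
      have := hδ i
      rw [mulVec_sub, mulVec_smul] at this
      simp only [Pi.sub_apply, Pi.smul_apply, smul_eq_mul] at this ⊢
      linarith)
  linarith

/-- Weak Perron–Frobenius theorem, Collatz–Wielandt form. -/
theorem exists_perron_of_nonneg [Nonempty ι] (T : Matrix ι ι ℝ) (hT : ∀ i j, 0 ≤ T i j) :
    ∃ r : ℝ, 0 ≤ r ∧ ∃ x : ι → ℝ, 0 ≤ x ∧ x ≠ 0 ∧ T *ᵥ x = r • x ∧
      ∀ (s : ℝ) (w : ι → ℝ), 0 ≤ w → w ≠ 0 → s • w ≤ T *ᵥ w → s ≤ r := by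
  -- Perturb to positive matrices and pass to a convergent subsequence of Perron pairs. Since `T ≤ P
  -- m`, the maximality bound survives in the limit.
  let P : ℕ → Matrix ι ι ℝ := fun m => Matrix.of fun i j => T i j + 1 / ((m : ℝ) + 1)
  have hP : ∀ m i j, P m i j = T i j + 1 / ((m : ℝ) + 1) := fun _ _ _ => rfl
  have hone : ∀ m : ℕ, 0 < 1 / ((m : ℝ) + 1) := fun m => Nat.one_div_pos_of_nat
  have hone' : ∀ m : ℕ, 1 / ((m : ℝ) + 1) ≤ 1 := fun m => by
    rw [div_le_one (by positivity)]
    linarith [(Nat.cast_nonneg m : (0 : ℝ) ≤ m)]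
  choose r hr0 hrC x hx hrx hbd using fun m => exists_perron_of_pos (P m)
    (fun i j => add_pos_of_nonneg_of_pos (hT i j) (hone m))
  have hmem : ∀ m, (r m, x m) ∈ Set.Icc (0 : ℝ) (∑ i, ∑ j, (T i j + 1)) ×ˢ stdSimplex ℝ ι := by
    refine fun m => ⟨⟨hr0 m, (hrC m).trans ?_⟩, hx m⟩
    exact Finset.sum_le_sum fun i _ => Finset.sum_le_sum fun j _ => by
      rw [hP]; linarith [hone' m]
  obtain ⟨⟨r₀, x₀⟩, ⟨hr₀, hx₀⟩, φ, hφ, hlim⟩ :=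
    (isCompact_Icc.prod (isCompact_stdSimplex ℝ ι)).tendsto_subseq hmem
  have hlr : Tendsto (fun m => r (φ m)) atTop (𝓝 r₀) := (continuous_fst.tendsto _).comp hlim
  have hlx : Tendsto (fun m => x (φ m)) atTop (𝓝 x₀) := (continuous_snd.tendsto _).comp hlim
  have hlP : ∀ i j, Tendsto (fun m => P (φ m) i j) atTop (𝓝 (T i j)) := by
    intro i j
    have := (tendsto_one_div_add_atTop_nhds_zero_nat (𝕜 := ℝ)).comp hφ.tendsto_atTop
    simpa [hP] using this.const_add (T i j)
  refine ⟨r₀, hr₀.1, x₀, hx₀.1, ?_, ?_, ?_⟩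
  · rintro rfl
    simpa using hx₀.2
  · funext i
    have h1 : Tendsto (fun m => (P (φ m) *ᵥ x (φ m)) i) atTop (𝓝 ((T *ᵥ x₀) i)) :=
      tendsto_finsetSum _ fun j _ => (hlP i j).mul ((tendsto_pi_nhds.1 hlx) j)
    have h2 : Tendsto (fun m => (r (φ m) • x (φ m)) i) atTop (𝓝 ((r₀ • x₀) i)) :=
      hlr.mul ((tendsto_pi_nhds.1 hlx) i)
    simp only [hrx] at h1
    exact tendsto_nhds_unique h1 h2
  · intro s w hw hw0 hsw
    refine ge_of_tendsto' hlr fun m => hbd _ s w hw hw0 (hsw.trans fun i => ?_)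
    exact Finset.sum_le_sum fun j _ => mul_le_mul_of_nonneg_right
      (le_add_of_nonneg_right (hone (φ m)).le) (hw j)

end Perron

/-! ### Perron vectors for the complex spectral radius. -/

theorem exists_mulVec_eq_of_mem_spectrum {n : ℕ} {T : Matrix (Fin n) (Fin n) ℂ} {μ : ℂ}
    (hμ : μ ∈ spectrum ℂ T) : ∃ u : Fin n → ℂ, u ≠ 0 ∧ T *ᵥ u = μ • u := by
  rw [← Matrix.spectrum_toLin', ← Module.End.hasEigenvalue_iff_mem_spectrum] at hμ
  obtain ⟨u, hu⟩ := hμ.exists_hasEigenvector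
  exact ⟨u, hu.2, by simpa using hu.apply_eq_smul⟩

theorem mem_spectrum_of_mulVec_eq {n : ℕ} {T : Matrix (Fin n) (Fin n) ℂ} {μ : ℂ}
    {u : Fin n → ℂ} (hu : u ≠ 0) (h : T *ᵥ u = μ • u) : μ ∈ spectrum ℂ T := by
  rw [← Matrix.spectrum_toLin']
  refine (Module.End.hasEigenvalue_of_hasEigenvector (x := u) ⟨?_, hu⟩).mem_spectrum
  rw [Module.End.mem_eigenspace_iff]
  simpa using h

/-- Weak Perron–Frobenius theorem: the spectral radius of a nonnegative matrix is an eigenvalue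
with a nonnegative eigenvector. -/
theorem exists_specRadius_eigenvector {n : ℕ} [Nonempty (Fin n)] (T : Matrix (Fin n) (Fin n) ℝ)
    (hT : ∀ i j, 0 ≤ T i j) :
    ∃ r : ℝ, 0 ≤ r ∧ specRadius T = ENNReal.ofReal r ∧
      ∃ x : Fin n → ℝ, 0 ≤ x ∧ x ≠ 0 ∧ T *ᵥ x = r • x := by
  obtain ⟨r, hr0, x, hx, hx0, hrx, hbd⟩ := exists_perron_of_nonneg T hT
  refine ⟨r, hr0, le_antisymm ?_ ?_, x, hx, hx0, hrx⟩
  · refine iSup₂_le fun μ hμ => ?_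
    obtain ⟨u, hu0, hu⟩ := exists_mulVec_eq_of_mem_spectrum hμ
    -- The vector of moduli `|u|` satisfies `|μ| |u| ≤ T |u|` by the triangle inequality, so it is a
    -- Collatz–Wielandt test vector.
    have hle : ‖μ‖ ≤ r := by
      refine hbd ‖μ‖ (fun i => ‖u i‖) (fun i => norm_nonneg _) (fun h => hu0 ?_) fun i => ?_
      · funext i
        simpa using congrFun h i
      · have h1 := congrFun hu i
        simp only [Pi.smul_apply, smul_eq_mul] at h1 ⊢
        rw [← norm_mul, ← h1]
        refine (norm_sum_le (E := ℂ) _ _).trans (Finset.sum_le_sum fun j _ => ?_)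
        simp [abs_of_nonneg (hT i j)]
    rw [← enorm_eq_nnnorm, ← ofReal_norm]
    exact ENNReal.ofReal_le_ofReal hle
  · have hmem : (r : ℂ) ∈ spectrum ℂ (T.map Complex.ofReal) := by
      refine mem_spectrum_of_mulVec_eq (u := fun i => (x i : ℂ)) (fun h => hx0 ?_) ?_
      · funext i
        simpa using congrFun h i
      · funext i
        have := congrArg (Complex.ofReal) (congrFun hrx i)
        simpa [mulVec, dotProduct] using this
    refine le_trans (le_of_eq ?_) (le_iSup₂ (f := fun k (_ : k ∈ spectrum ℂ _) => (‖k‖₊ : ℝ≥0∞))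
      (r : ℂ) hmem)
    rw [← enorm_eq_nnnorm, ← ofReal_norm]
    simp [abs_of_nonneg hr0]

theorem specRadius_transpose {n : ℕ} (T : Matrix (Fin n) (Fin n) ℝ) :
    specRadius Tᵀ = specRadius T := by
  have h : spectrum ℂ (Tᵀ.map Complex.ofReal) = spectrum ℂ (T.map Complex.ofReal) := by
    ext μ
    rw [Matrix.mem_spectrum_iff_isRoot_charpoly, Matrix.mem_spectrum_iff_isRoot_charpoly,
      ← Matrix.charpoly_transpose (T.map Complex.ofReal), Matrix.transpose_map]
  unfold specRadius spectralRadius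
  rw [h]

/-- Left and right Perron vectors of a nonnegative matrix. -/
theorem exists_specRadius_eigenvectors {n : ℕ} [Nonempty (Fin n)] (T : Matrix (Fin n) (Fin n) ℝ)
    (hT : ∀ i j, 0 ≤ T i j) :
    ∃ r : ℝ, 0 ≤ r ∧ specRadius T = ENNReal.ofReal r ∧
      (∃ x : Fin n → ℝ, 0 ≤ x ∧ x ≠ 0 ∧ T *ᵥ x = r • x) ∧
      ∃ y : Fin n → ℝ, 0 ≤ y ∧ y ≠ 0 ∧ y ᵥ* T = r • y := by
  obtain ⟨r, hr0, hr, hx⟩ := exists_specRadius_eigenvector T hT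
  obtain ⟨s, hs0, hs, y, hy, hy0, hsy⟩ := exists_specRadius_eigenvector Tᵀ fun i j => hT j i
  rw [specRadius_transpose, hr, ENNReal.ofReal_eq_ofReal_iff hr0 hs0] at hs
  subst hs
  exact ⟨r, hr0, hr, hx, y, hy, hy0, by rwa [mulVec_transpose] at hsy⟩

/-! ### Irreducibility through closed index sets. -/

section Irreducible

variable {n : ℕ} {B : Matrix (Fin n) (Fin n) ℝ}

/-- An index set that no edge of an irreducible matrix leaves is empty or everything. -/
theorem IsIrreducible.eq_univ (hB : IsIrreducible B) {S : Set (Fin n)} (hS : S.Nonempty)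
    (h : ∀ i ∈ S, ∀ j ∉ S, B i j = 0) : S = Set.univ := by
  classical
  by_contra hne
  apply hB
  -- The complement of `S` is to be numbered first, so the zero block has its rows in `S` and its
  -- columns outside.
  set r := Fintype.card {j // j ∉ S} with hr
  obtain ⟨a, ha⟩ := hS
  obtain ⟨b, hb⟩ := (Set.ne_univ_iff_exists_notMem S).1 hne
  have hrn : r < n := by
    have := Fintype.card_subtype_lt (p := fun j => j ∉ S) (x := a) (not_not.2 ha)
    rwa [Fintype.card_fin] at this
  have hcard : Fintype.card {j : Fin n // (j : ℕ) < r} = Fintype.card {j // j ∉ S} := by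
    rw [← hr, Fintype.card_subtype]
    rw [Fin.card_filter_val_lt, min_eq_right hrn.le]
  let e := Fintype.equivOfCardEq hcard
  refine ⟨e.extendSubtype, r, Fintype.card_pos_iff.2 ⟨⟨b, hb⟩⟩, hrn, fun i j hi hj => ?_⟩
  exact h _ (not_not.1 (e.extendSubtype_not_mem i (not_lt.2 hi))) _ (e.extendSubtype_mem j hj)

theorem IsIrreducible.exists_ne_zero (hB : IsIrreducible B) (hn : 1 < n) (i : Fin n) :
    ∃ j, j ≠ i ∧ B i j ≠ 0 := by
  by_contra! h
  have hS := hB.eq_univ (S := {i}) (Set.singleton_nonempty i)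
    (by rintro _ rfl j hj; exact h j hj)
  have : Nontrivial (Fin n) := Fin.nontrivial_iff_two_le.2 hn
  obtain ⟨j, hj⟩ := exists_ne i
  exact hj (by simpa using (hS ▸ Set.mem_univ j : j ∈ ({i} : Set (Fin n))))

theorem IsIrreducible.of_pattern {C : Matrix (Fin n) (Fin n) ℝ} (hB : IsIrreducible B)
    (h : ∀ i j, i ≠ j → C i j = 0 → B i j = 0) : IsIrreducible C := by
  rintro ⟨σ, r, h1, h2, h3⟩
  refine hB ⟨σ, r, h1, h2, fun i j hi hj => h _ _ (fun hij => ?_) (h3 i j hi hj)⟩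
  have := σ.injective hij
  subst this
  omega

end Irreducible

/-! ### The splitting `B = M - N` and its Perron data. -/

/-- The matrix `D - γ L` for `B = D - L - U`. -/
def aorM {n : ℕ} (B : Matrix (Fin n) (Fin n) ℝ) (γ : ℝ) : Matrix (Fin n) (Fin n) ℝ :=
  diagPart B - γ • lowerPart B

/-- The matrix `(1 - γ) L + U` for `B = D - L - U`. -/
def aorN {n : ℕ} (B : Matrix (Fin n) (Fin n) ℝ) (γ : ℝ) : Matrix (Fin n) (Fin n) ℝ :=
  (1 - γ) • lowerPart B + upperPart B

theorem mulVec_nonneg {n : ℕ} {T : Matrix (Fin n) (Fin n) ℝ} (hT : ∀ i j, 0 ≤ T i j)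
    {x : Fin n → ℝ} (hx : 0 ≤ x) : 0 ≤ T *ᵥ x := by
  intro i
  change 0 ≤ ∑ j, T i j * x j
  exact Finset.sum_nonneg fun j _ => mul_nonneg (hT i j) (hx j)

theorem vecMul_nonneg {n : ℕ} {T : Matrix (Fin n) (Fin n) ℝ} {y : Fin n → ℝ} (hy : 0 ≤ y)
    (hT : ∀ i j, 0 ≤ T i j) : 0 ≤ y ᵥ* T := by
  rw [← mulVec_transpose]
  exact mulVec_nonneg (fun i j => hT j i) hy

section Splitting

variable {n : ℕ} (B : Matrix (Fin n) (Fin n) ℝ) {γ : ℝ}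

theorem aorM_diag (i : Fin n) : aorM B γ i i = B i i := by
  simp [aorM, diagPart, lowerPart]

theorem aorM_of_lt {i j : Fin n} (h : j < i) : aorM B γ i j = γ * B i j := by
  simp [aorM, diagPart, lowerPart, h, Matrix.diagonal_apply_ne _ h.ne']

theorem aorM_of_gt {i j : Fin n} (h : i < j) : aorM B γ i j = 0 := by
  simp [aorM, diagPart, lowerPart, h.not_gt, Matrix.diagonal_apply_ne _ h.ne]

theorem aorN_diag (i : Fin n) : aorN B γ i i = 0 := by
  simp [aorN, upperPart, lowerPart]

theorem aorN_of_lt {i j : Fin n} (h : j < i) : aorN B γ i j = -((1 - γ) * B i j) := by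
  simp [aorN, upperPart, lowerPart, h, h.not_gt]

theorem aorN_of_gt {i j : Fin n} (h : i < j) : aorN B γ i j = -B i j := by
  simp [aorN, upperPart, lowerPart, h, h.not_gt]

theorem aorM_sub_aorN : aorM B γ - aorN B γ = B := by
  ext i j
  rw [Matrix.sub_apply]
  rcases lt_trichotomy i j with h | rfl | h
  · rw [aorM_of_gt B h, aorN_of_gt B h]; ring
  · rw [aorM_diag, aorN_diag]; ring
  · rw [aorM_of_lt B h, aorN_of_lt B h]; ring

variable {B}

theorem isUnit_det_aorM (hB : ∀ i, 0 < B i i) : IsUnit (aorM B γ).det := by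
  rw [Matrix.det_of_isLowerTriangular _ (fun i j h => aorM_of_gt B h)]
  simp only [aorM_diag]
  exact (Finset.prod_pos fun i _ => hB i).ne'.isUnit

/-- Forward substitution: `M` is lower triangular with positive diagonal and nonpositive entries
below it. -/
theorem IsLMatrix.nonneg_of_aorM_mulVec_nonneg (hB : IsLMatrix B) (hγ0 : 0 ≤ γ) {u : Fin n → ℝ}
    (hu : 0 ≤ aorM B γ *ᵥ u) : 0 ≤ u := by
  intro i
  induction i using WellFoundedLT.induction with
  | ind i ih =>
    have h1 : 0 ≤ ∑ j, aorM B γ i j * u j := hu i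
    rw [← Finset.add_sum_erase _ _ (Finset.mem_univ i), aorM_diag] at h1
    have h2 : ∑ j ∈ Finset.univ.erase i, aorM B γ i j * u j ≤ 0 := by
      refine Finset.sum_nonpos fun j hj => ?_
      rcases lt_or_gt_of_ne (Finset.ne_of_mem_erase hj) with h | h
      · rw [aorM_of_lt B h]
        exact mul_nonpos_of_nonpos_of_nonneg
          (mul_nonpos_of_nonneg_of_nonpos hγ0 (hB.1 i j h.ne')) (ih j h)
      · rw [aorM_of_gt B h, zero_mul]
    exact nonneg_of_mul_nonneg_right (by linarith) (hB.2 i)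

theorem IsLMatrix.aorM_inv_nonneg (hB : IsLMatrix B) (hγ0 : 0 ≤ γ) (i j : Fin n) :
    0 ≤ (aorM B γ)⁻¹ i j := by
  have h : 0 ≤ (aorM B γ)⁻¹ *ᵥ Pi.single j 1 := by
    refine hB.nonneg_of_aorM_mulVec_nonneg hγ0 ?_
    rw [mulVec_mulVec, mul_nonsing_inv _ (isUnit_det_aorM hB.2), one_mulVec]
    intro k
    exact (Pi.single_nonneg.2 zero_le_one : (0 : Fin n → ℝ) ≤ Pi.single j 1) k
  simpa using h i

theorem IsLMatrix.aorN_nonneg (hB : IsLMatrix B) (hγ1 : γ ≤ 1) (i j : Fin n) :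
    0 ≤ aorN B γ i j := by
  rcases lt_trichotomy i j with h | rfl | h
  · rw [aorN_of_gt B h]; exact neg_nonneg.2 (hB.1 i j h.ne)
  · rw [aorN_diag]
  · rw [aorN_of_lt B h]
    exact neg_nonneg.2 (mul_nonpos_of_nonneg_of_nonpos (sub_nonneg.2 hγ1) (hB.1 i j h.ne'))

theorem aorMatrix_eq (hB : ∀ i, 0 < B i i) (γ ω : ℝ) :
    aorMatrix B γ ω = (1 - ω) • (1 : Matrix (Fin n) (Fin n) ℝ) +
      ω • ((aorM B γ)⁻¹ * aorN B γ) := by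
  have h : (1 - ω) • diagPart B + (ω - γ) • lowerPart B + ω • upperPart B =
      (1 - ω) • aorM B γ + ω • aorN B γ := by
    unfold aorM aorN
    module
  change (aorM B γ)⁻¹ * _ = _
  rw [h, mul_add, mul_smul_comm, mul_smul_comm, nonsing_inv_mul _ (isUnit_det_aorM hB)]

theorem affine_eigen {E : Type*} [AddCommGroup E] [Module ℝ E] {ω r : ℝ} (hω : 0 < ω) {a b : E}
    (h : (1 - ω) • a + ω • b = r • a) : b = ((r - 1 + ω) / ω) • a := by
  have h1 : ω • b = (r - 1 + ω) • a := by
    rw [← sub_eq_iff_eq_add'.2 h.symm]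
    module
  rw [div_eq_inv_mul, mul_smul, ← h1, smul_smul, inv_mul_cancel₀ hω.ne', one_smul]

/-- Perron data of the AOR iteration matrix of an L-matrix `M - N`, expressed by the pencil
`N - ρ M`. -/
theorem IsLMatrix.exists_perron [Nonempty (Fin n)] (hB : IsLMatrix B) {ω : ℝ} (hω0 : 0 < ω)
    (hω1 : ω ≤ 1) (hγ0 : 0 ≤ γ) (hγ1 : γ ≤ 1) :
    ∃ ρ : ℝ, 0 ≤ ρ ∧ specRadius (aorMatrix B γ ω) = ENNReal.ofReal (1 - ω + ω * ρ) ∧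
      (∃ x : Fin n → ℝ, 0 ≤ x ∧ x ≠ 0 ∧ aorN B γ *ᵥ x = ρ • (aorM B γ *ᵥ x)) ∧
      ∃ v : Fin n → ℝ, 0 ≤ v ∧ v ≠ 0 ∧ 0 ≤ v ᵥ* aorM B γ ∧ v ᵥ* aorM B γ ≠ 0 ∧
        v ᵥ* aorN B γ = ρ • (v ᵥ* aorM B γ) := by
  have hu := isUnit_det_aorM (γ := γ) hB.2
  have hT1 : ∀ i j, 0 ≤ ((aorM B γ)⁻¹ * aorN B γ) i j := fun i j => by
    rw [Matrix.mul_apply]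
    exact Finset.sum_nonneg fun k _ =>
      mul_nonneg (hB.aorM_inv_nonneg hγ0 i k) (hB.aorN_nonneg hγ1 k j)
  have hT : ∀ i j, 0 ≤ aorMatrix B γ ω i j := by
    intro i j
    rw [aorMatrix_eq hB.2, Matrix.add_apply, Matrix.smul_apply, Matrix.smul_apply]
    refine add_nonneg (mul_nonneg (sub_nonneg.2 hω1) ?_) (mul_nonneg hω0.le (hT1 i j))
    rw [Matrix.one_apply]
    split_ifs <;> norm_num
  obtain ⟨r, hr0, hr, ⟨x, hx, hx0, hrx⟩, y, hy, hy0, hry⟩ := exists_specRadius_eigenvectors _ hT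
  rw [aorMatrix_eq hB.2, add_mulVec, smul_mulVec, smul_mulVec, one_mulVec] at hrx
  rw [aorMatrix_eq hB.2, vecMul_add, vecMul_smul, vecMul_smul, vecMul_one] at hry
  have hx1 := affine_eigen hω0 hrx
  have hy1 := affine_eigen hω0 hry
  set ρ := (r - 1 + ω) / ω with hρ
  refine ⟨ρ, ?_, ?_, ⟨x, hx, hx0, ?_⟩, y ᵥ* (aorM B γ)⁻¹, ?_, ?_, ?_⟩
  · obtain ⟨i, hi⟩ := Function.ne_iff.1 hx0
    have hi : 0 < x i := lt_of_le_of_ne (hx i) (Ne.symm hi)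
    have h1 : 0 ≤ (((aorM B γ)⁻¹ * aorN B γ) *ᵥ x) i :=
      mulVec_nonneg hT1 hx i
    rw [hx1] at h1
    exact nonneg_of_mul_nonneg_left h1 hi
  · rw [hr, hρ, mul_div_cancel₀ _ hω0.ne']
    congr 1
    ring
  · rw [← mulVec_smul, ← hx1, mulVec_mulVec, ← mul_assoc, mul_nonsing_inv _ hu, one_mul]
  · exact vecMul_nonneg hy (hB.aorM_inv_nonneg hγ0)
  · intro h
    apply hy0
    have := congrArg (· ᵥ* aorM B γ) h
    simpa [vecMul_vecMul, nonsing_inv_mul _ hu] using this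
  · rw [vecMul_vecMul, vecMul_vecMul, nonsing_inv_mul _ hu, vecMul_one]
    exact ⟨hy, hy0, hy1⟩

/-- Off the diagonal, `N - ρM` has the zero pattern of `B`. For `γ = 1` this fails for `N` alone;
the part below the diagonal is then supplied by `ρM`, hence `ρ > 0`. -/
theorem exists_aorN_sub_eq (B : Matrix (Fin n) (Fin n) ℝ) {ρ : ℝ} (hγ0 : 0 ≤ γ) (hγ1 : γ ≤ 1)
    (hρ : 0 < ρ) {i j : Fin n} (hij : i ≠ j) :
    ∃ c : ℝ, 0 < c ∧ aorN B γ i j - ρ * aorM B γ i j = c * -B i j := by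
  rcases lt_or_gt_of_ne hij with h | h
  · exact ⟨1, one_pos, by rw [aorN_of_gt B h, aorM_of_gt B h]; ring⟩
  · refine ⟨1 - γ + γ * ρ, ?_, by rw [aorN_of_lt B h, aorM_of_lt B h]; ring⟩
    rcases hγ1.lt_or_eq with h1 | rfl
    · have := mul_nonneg hγ0 hρ.le
      linarith
    · linarith

/-- A nonnegative combination that vanishes, apart from a term with zero weight. -/
theorem eq_zero_of_sum_eq_zero {ι : Type*} [Fintype ι] {x f : ι → ℝ} (hx : 0 ≤ x) {i : ι}
    (hi : x i = 0) (hf : ∀ j, j ≠ i → 0 ≤ f j) (h : ∑ j, f j * x j = 0) {j : ι}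
    (hfj : 0 < f j) : x j = 0 := by
  have h1 : ∀ k ∈ Finset.univ, 0 ≤ f k * x k := by
    intro k _
    by_cases hk : k = i
    · rw [hk, hi, mul_zero]
    · exact mul_nonneg (hf k hk) (hx k)
  have := (Finset.sum_eq_zero_iff_of_nonneg h1).1 h j (Finset.mem_univ j)
  exact (mul_eq_zero.1 this).resolve_left hfj.ne'

/-- By the row equations of `(N - ρM)x = 0`, no edge of `B` leaves the zero set of `x`. -/
theorem IsLMatrix.right_perron_pos (hB : IsLMatrix B) (hirr : IsIrreducible B) (hγ0 : 0 ≤ γ)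
    (hγ1 : γ ≤ 1) {ρ : ℝ} (hρ : 0 < ρ) {x : Fin n → ℝ} (hx : 0 ≤ x) (hx0 : x ≠ 0)
    (h : aorN B γ *ᵥ x = ρ • (aorM B γ *ᵥ x)) (i : Fin n) : 0 < x i := by
  refine lt_of_le_of_ne (hx i) fun hi => hx0 ?_
  have hS := hirr.eq_univ (S := {i | x i = 0}) ⟨i, hi.symm⟩ (by
    intro i hi j hj
    by_contra hne
    have hij : j ≠ i := by rintro rfl; exact hj hi
    refine hj (eq_zero_of_sum_eq_zero hx hi
      (f := fun j => aorN B γ i j - ρ * aorM B γ i j) (fun k hk => ?_) ?_ ?_)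
    · obtain ⟨c, hc, he⟩ := exists_aorN_sub_eq B hγ0 hγ1 hρ hk.symm
      rw [he]
      exact mul_nonneg hc.le (neg_nonneg.2 (hB.1 i k hk.symm))
    · have := congrFun h i
      simp only [mulVec, dotProduct, Pi.smul_apply, smul_eq_mul, Finset.mul_sum] at this
      rw [← sub_eq_zero, ← Finset.sum_sub_distrib] at this
      rw [← this]
      exact Finset.sum_congr rfl fun k _ => by ring
    · obtain ⟨c, hc, he⟩ := exists_aorN_sub_eq B hγ0 hγ1 hρ hij.symm
      rw [he]
      exact mul_pos hc (neg_pos.2 (lt_of_le_of_ne (hB.1 i j hij.symm) hne)))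
  funext k
  exact (hS ▸ Set.mem_univ k : k ∈ {i | x i = 0})

/-- Dually, the column equations show that no edge leaves the support of `v`. -/
theorem IsLMatrix.left_perron_pos (hB : IsLMatrix B) (hirr : IsIrreducible B) (hγ0 : 0 ≤ γ)
    (hγ1 : γ ≤ 1) {ρ : ℝ} (hρ : 0 < ρ) {v : Fin n → ℝ} (hv : 0 ≤ v) (hv0 : v ≠ 0)
    (h : v ᵥ* aorN B γ = ρ • (v ᵥ* aorM B γ)) (i : Fin n) : 0 < v i := by
  have hS := hirr.eq_univ (S := {i | v i ≠ 0}) (Function.ne_iff.1 hv0) (by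
    intro i hi j hj
    by_contra hne
    have hj : v j = 0 := not_not.1 hj
    have hij : i ≠ j := by rintro rfl; exact hi hj
    refine hi (eq_zero_of_sum_eq_zero hv hj
      (f := fun i => aorN B γ i j - ρ * aorM B γ i j) (fun k hk => ?_) ?_ ?_)
    · obtain ⟨c, hc, he⟩ := exists_aorN_sub_eq B hγ0 hγ1 hρ hk
      rw [he]
      exact mul_nonneg hc.le (neg_nonneg.2 (hB.1 k j hk))
    · have := congrFun h j
      simp only [vecMul, dotProduct, Pi.smul_apply, smul_eq_mul, Finset.mul_sum] at this
      rw [← sub_eq_zero, ← Finset.sum_sub_distrib] at this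
      rw [← this]
      exact Finset.sum_congr rfl fun k _ => by ring
    · obtain ⟨c, hc, he⟩ := exists_aorN_sub_eq B hγ0 hγ1 hρ hij
      rw [he]
      exact mul_pos hc (neg_pos.2 (lt_of_le_of_ne (hB.1 i j hij) hne)))
  exact lt_of_le_of_ne (hv i) (Ne.symm (hS ▸ Set.mem_univ i : i ∈ {i | v i ≠ 0}))

/-- The iteration matrix of an irreducible L-matrix has no zero row. -/
theorem IsLMatrix.inv_mul_one_pos (hB : IsLMatrix B) (hirr : IsIrreducible B) (hn : 1 < n)
    (hγ0 : 0 ≤ γ) (hγ1 : γ ≤ 1) {u : Fin n → ℝ} (hu : aorM B γ *ᵥ u = aorN B γ *ᵥ 1)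
    (i : Fin n) : 0 < u i := by
  have hu0 : 0 ≤ u := hB.nonneg_of_aorM_mulVec_nonneg hγ0 (by
    rw [hu]
    exact mulVec_nonneg (hB.aorN_nonneg hγ1) zero_le_one)
  have hterm : ∀ i j, j ≠ i → 0 ≤ aorN B γ i j - aorM B γ i j * u j := by
    intro i j hij
    rcases lt_or_gt_of_ne hij with h | h
    · rw [aorN_of_lt B h, aorM_of_lt B h]
      have h1 := mul_nonneg hγ0 (hu0 j)
      have h2 := hB.1 i j hij.symm
      have h3 : 0 ≤ (1 - γ + γ * u j) * -B i j :=
        mul_nonneg (add_nonneg (sub_nonneg.2 hγ1) h1) (neg_nonneg.2 h2)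
      linarith
    · rw [aorN_of_gt B h, aorM_of_gt B h]
      linarith [hB.1 i j hij.symm]
  -- If `u i = 0`, row `i` of `N 1 - M u = 0` is a sum of nonnegative terms. An edge to `j > i`
  -- would contribute `-B i j > 0`; an edge to `j < i` contributes `-B i j (1 - γ + γ u j)`, which
  -- vanishes only if `γ = 1` and `u j = 0`.
  have hzero : ∀ i, u i = 0 → ∀ j, j ≠ i → B i j ≠ 0 → j < i ∧ u j = 0 := by
    intro i hi j hij hne
    have h1 := congrFun hu i
    simp only [mulVec, dotProduct, Pi.one_apply, mul_one] at h1
    have hsum : ∑ j, (aorN B γ i j - aorM B γ i j * u j) = 0 := by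
      rw [Finset.sum_sub_distrib, h1, sub_self]
    have hz := (Finset.sum_eq_zero_iff_of_nonneg (fun k _ => by
      by_cases hk : k = i
      · rw [hk, aorN_diag, hi, mul_zero, sub_zero]
      · exact hterm i k hk)).1 hsum j (Finset.mem_univ j)
    have h2 := lt_of_le_of_ne (hB.1 i j hij.symm) hne
    rcases lt_or_gt_of_ne hij with h | h
    · refine ⟨h, ?_⟩
      rw [aorN_of_lt B h, aorM_of_lt B h] at hz
      have h3 : B i j * (1 - γ + γ * u j) = 0 := by linarith
      have h4 := (mul_eq_zero.1 h3).resolve_left hne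
      have h5 := mul_nonneg hγ0 (hu0 j)
      have hγ : γ = 1 := by linarith
      simpa [hγ] using h4
    · rw [aorN_of_gt B h, aorM_of_gt B h] at hz
      linarith
  refine lt_of_le_of_ne (hu0 i) fun hi => ?_
  have hS := hirr.eq_univ (S := {i | u i = 0}) ⟨i, hi.symm⟩ (by
    intro i hi j hj
    by_contra hne
    exact hj (hzero i hi j (by rintro rfl; exact hj hi) hne).2)
  -- The zero set is now everything, but an edge out of the first index cannot lead to a smaller
  -- one.
  let z : Fin n := ⟨0, by omega⟩
  obtain ⟨j, hj, hne⟩ := hirr.exists_ne_zero hn z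
  have := (hzero z (hS ▸ Set.mem_univ z : z ∈ {i | u i = 0}) j hj hne).1
  exact absurd this (Nat.not_lt_zero _)

/-- Pair the left eigenvector `v M` of `M⁻¹N` with the positive vector `M⁻¹N 1`. -/
theorem IsLMatrix.perron_root_pos (hB : IsLMatrix B) (hirr : IsIrreducible B) (hn : 1 < n)
    (hγ0 : 0 ≤ γ) (hγ1 : γ ≤ 1) {ρ : ℝ} {v : Fin n → ℝ} (hv : 0 ≤ v ᵥ* aorM B γ)
    (hv0 : v ᵥ* aorM B γ ≠ 0) (h : v ᵥ* aorN B γ = ρ • (v ᵥ* aorM B γ)) : 0 < ρ := by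
  set u := (aorM B γ)⁻¹ *ᵥ (aorN B γ *ᵥ 1) with hu
  have hMu : aorM B γ *ᵥ u = aorN B γ *ᵥ 1 := by
    rw [hu, mulVec_mulVec, mul_nonsing_inv _ (isUnit_det_aorM hB.2), one_mulVec]
  have hpos := hB.inv_mul_one_pos hirr hn hγ0 hγ1 hMu
  have key : (v ᵥ* aorM B γ) ⬝ᵥ u = ρ * ((v ᵥ* aorM B γ) ⬝ᵥ 1) := by
    rw [← dotProduct_mulVec, hMu, dotProduct_mulVec, h, smul_dotProduct, smul_eq_mul]
  obtain ⟨j, hj⟩ := Function.ne_iff.1 hv0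
  have hlt : 0 < (v ᵥ* aorM B γ) ⬝ᵥ u :=
    Finset.sum_pos' (fun k _ => mul_nonneg (hv k) (hpos k).le)
      ⟨j, Finset.mem_univ j, mul_pos (lt_of_le_of_ne (hv j) (Ne.symm hj)) (hpos j)⟩
  rw [key] at hlt
  exact pos_of_mul_pos_left hlt
    (Finset.sum_nonneg fun k _ => mul_nonneg (hv k) zero_le_one)

end Splitting

/-! ### The preconditioned matrix and the comparison vector. -/

section Precond

variable {n : ℕ} {A : Matrix (Fin n) (Fin n) ℝ} {α : Fin n → Fin n → ℝ} {γ : ℝ}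

theorem upperQ_mul_apply (A C : Matrix (Fin n) (Fin n) ℝ) (α : Fin n → Fin n → ℝ) (i j : Fin n) :
    (upperQ A α * C) i j = -∑ k ∈ Finset.Ioi i, α i k * A i k * C k j := by
  rw [Matrix.mul_apply, ← Finset.sum_neg_distrib]
  simp only [upperQ, Matrix.of_apply, ite_mul, zero_mul, ← Finset.sum_filter]
  refine Finset.sum_congr (by ext; simp) fun k _ => by ring

theorem precondMatrix_apply (A : Matrix (Fin n) (Fin n) ℝ) (α : Fin n → Fin n → ℝ)
    (i j : Fin n) :
    precondMatrix A α i j = A i j - ∑ k ∈ Finset.Ioi i, α i k * A i k * A k j := by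
  rw [precondMatrix, add_mul, one_mul, Matrix.add_apply, upperQ_mul_apply, sub_eq_add_neg]

theorem precondMatrix_of_lt (hdiag : ∀ i, A i i = 1) {i j : Fin n} (h : i < j) :
    precondMatrix A α i j = upperExpr A α i j := by
  rw [precondMatrix_apply, upperExpr, ← Finset.add_sum_erase _ _ (Finset.mem_Ioi.2 h), hdiag j]
  ring

theorem IsLMatrix.coeff_nonpos (hA : IsLMatrix A) (hα : ∀ i j : Fin n, i < j → 0 ≤ α i j)
    {i k : Fin n} (h : i < k) : α i k * A i k ≤ 0 :=
  mul_nonpos_of_nonneg_of_nonpos (hα i k h) (hA.1 i k h.ne)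

theorem IsLMatrix.term_nonneg (hA : IsLMatrix A) (hα : ∀ i j : Fin n, i < j → 0 ≤ α i j)
    {i j k : Fin n} (hik : i < k) (hkj : k ≠ j) : 0 ≤ α i k * A i k * A k j :=
  mul_nonneg_of_nonpos_of_nonpos (hA.coeff_nonpos hα hik) (hA.1 k j hkj)

theorem IsLMatrix.upperExpr_nonpos_of_eq_zero (hA : IsLMatrix A)
    (hα : ∀ i j : Fin n, i < j → 0 ≤ α i j) {i j : Fin n} (h0 : A i j = 0) :
    upperExpr A α i j ≤ 0 := by
  rw [upperExpr, h0, mul_zero, zero_sub]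
  refine neg_nonpos.2 (Finset.sum_nonneg fun k hk => ?_)
  rw [Finset.mem_erase, Finset.mem_Ioi] at hk
  exact hA.term_nonneg hα hk.2 hk.1

theorem LesssimCond.weakCond (hS : LesssimCond A α) (hA : IsLMatrix A)
    (hα : ∀ i j : Fin n, i < j → 0 ≤ α i j) : WeakCond A α := by
  intro i j hij
  rcases (hA.1 i j hij.ne).lt_or_eq with h | h
  · rcases hS i j hij h with h1 | h1
    · exact h1.le
    · exact h1.1.le
  · exact hA.upperExpr_nonpos_of_eq_zero hα h

theorem IsLMatrix.precond_le (hA : IsLMatrix A) (hα : ∀ i j : Fin n, i < j → 0 ≤ α i j)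
    {i j : Fin n} (h : j ≤ i) : precondMatrix A α i j ≤ A i j := by
  rw [precondMatrix_apply]
  refine sub_le_self _ (Finset.sum_nonneg fun k hk => ?_)
  rw [Finset.mem_Ioi] at hk
  exact hA.term_nonneg hα hk (h.trans_lt hk).ne'

theorem IsLMatrix.precond (hA : IsLMatrix A) (hdiag : ∀ i, A i i = 1)
    (hα : ∀ i j : Fin n, i < j → 0 ≤ α i j)
    (hsum : ∀ i : Fin n, (i : ℕ) + 1 < n → ∑ k ∈ Finset.Ioi i, α i k * A i k * A k i < 1)
    (hW : WeakCond A α) : IsLMatrix (precondMatrix A α) := by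
  refine ⟨fun i j hij => ?_, fun i => ?_⟩
  · rcases lt_or_gt_of_ne hij with h | h
    · rw [precondMatrix_of_lt hdiag h]
      exact hW i j h
    · exact (hA.precond_le hα h.le).trans (hA.1 i j hij)
  · rw [precondMatrix_apply, hdiag, sub_pos]
    by_cases hi : (i : ℕ) + 1 < n
    · exact hsum i hi
    · have : Finset.Ioi i = ∅ := by
        ext k
        simp only [Finset.mem_Ioi, Finset.notMem_empty, iff_false, not_lt, Fin.le_def]
        omega
      rw [this, Finset.sum_empty]
      exact one_pos

/-- Under the strong sign condition the preconditioned matrix is irreducible. -/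
theorem LesssimCond.isIrreducible (hS : LesssimCond A α) (hA : IsLMatrix A)
    (hirr : IsIrreducible A) (hdiag : ∀ i, A i i = 1) (hα : ∀ i j : Fin n, i < j → 0 ≤ α i j) :
    IsIrreducible (precondMatrix A α) := by
  -- Were the preconditioned matrix reducible, (S) would exclude equality, so every nonzero
  -- off-diagonal entry of `A` would stay nonzero and irreducibility would be inherited.
  by_contra hred
  refine hred (hirr.of_pattern fun i j hij h0 => ?_)
  by_contra hne
  have hlt := lt_of_le_of_ne (hA.1 i j hij) hne
  rcases lt_or_gt_of_ne hij with h | h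
  · rw [precondMatrix_of_lt hdiag h] at h0
    rcases hS i j h hlt with h1 | h1
    · exact h1.ne h0
    · exact hred h1.2
  · have := hA.precond_le hα h.le
    linarith

/-- The vector `((I + Q) M - M') x` that governs the comparison of the two splittings. -/
def comparisonVec (A : Matrix (Fin n) (Fin n) ℝ) (α : Fin n → Fin n → ℝ) (γ : ℝ)
    (x : Fin n → ℝ) : Fin n → ℝ :=
  (1 + upperQ A α) *ᵥ (aorM A γ *ᵥ x) - aorM (precondMatrix A α) γ *ᵥ x

theorem comparison_identity {ρ ρ' : ℝ} {x v : Fin n → ℝ}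
    (hx : aorN A γ *ᵥ x = ρ • (aorM A γ *ᵥ x))
    (hv : v ᵥ* aorN (precondMatrix A α) γ = ρ' • (v ᵥ* aorM (precondMatrix A α) γ)) :
    (ρ' - ρ) * ((v ᵥ* aorM (precondMatrix A α) γ) ⬝ᵥ x) =
      (ρ - 1) * (v ⬝ᵥ comparisonVec A α γ x) := by
  have hAx : A *ᵥ x = (1 - ρ) • (aorM A γ *ᵥ x) := by
    conv_lhs => rw [← aorM_sub_aorN A (γ := γ)]
    rw [sub_mulVec, hx, sub_smul, one_smul]
  have hBx : precondMatrix A α *ᵥ x = (1 - ρ) • ((1 + upperQ A α) *ᵥ (aorM A γ *ᵥ x)) := by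
    rw [precondMatrix, ← mulVec_mulVec, hAx, mulVec_smul]
  have h1 : v ⬝ᵥ (precondMatrix A α *ᵥ x) =
      (1 - ρ') * ((v ᵥ* aorM (precondMatrix A α) γ) ⬝ᵥ x) := by
    conv_lhs => rw [← aorM_sub_aorN (precondMatrix A α) (γ := γ)]
    rw [dotProduct_mulVec, vecMul_sub, hv, sub_dotProduct, smul_dotProduct, smul_eq_mul]
    ring
  rw [hBx, dotProduct_smul, smul_eq_mul] at h1
  rw [comparisonVec, dotProduct_sub, dotProduct_mulVec v (aorM (precondMatrix A α) γ)]
  linarith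

theorem IsLMatrix.aorM_precond_le (hA : IsLMatrix A) (hα : ∀ i j : Fin n, i < j → 0 ≤ α i j)
    (hγ0 : 0 ≤ γ) (i j : Fin n) : aorM (precondMatrix A α) γ i j ≤ aorM A γ i j := by
  rcases lt_trichotomy i j with h | rfl | h
  · rw [aorM_of_gt _ h, aorM_of_gt _ h]
  · rw [aorM_diag, aorM_diag]
    exact hA.precond_le hα le_rfl
  · rw [aorM_of_lt _ h, aorM_of_lt _ h]
    exact mul_le_mul_of_nonneg_left (hA.precond_le hα h.le) hγ0

/-- Trading `M x` for `ρ⁻¹ N x` makes every summand visibly nonnegative; `M` itself has entries of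
both signs. -/
theorem comparisonVec_apply {ρ : ℝ} (hρ : 0 < ρ) {x : Fin n → ℝ}
    (hx : aorN A γ *ᵥ x = ρ • (aorM A γ *ᵥ x)) (i : Fin n) :
    comparisonVec A α γ x i =
      ∑ j, (aorM A γ i j - aorM (precondMatrix A α) γ i j) * x j +
        ∑ k, upperQ A α i k * (ρ⁻¹ * (aorN A γ *ᵥ x) k) := by
  have h1 : aorM A γ *ᵥ x = ρ⁻¹ • (aorN A γ *ᵥ x) := by
    rw [hx, smul_smul, inv_mul_cancel₀ hρ.ne', one_smul]
  have h2 : (upperQ A α *ᵥ (aorM A γ *ᵥ x)) i =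
      ∑ k, upperQ A α i k * (ρ⁻¹ * (aorN A γ *ᵥ x) k) := by
    rw [h1]
    rfl
  rw [comparisonVec, add_mulVec, one_mulVec, Pi.sub_apply, Pi.add_apply, h2]
  simp only [sub_mul, Finset.sum_sub_distrib]
  change ∑ j, aorM A γ i j * x j + _ - ∑ j, aorM (precondMatrix A α) γ i j * x j = _
  ring

theorem IsLMatrix.upperQ_nonneg (hA : IsLMatrix A) (hα : ∀ i j : Fin n, i < j → 0 ≤ α i j)
    (i k : Fin n) : 0 ≤ upperQ A α i k := by
  simp only [upperQ, Matrix.of_apply]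
  split_ifs with h
  · exact neg_nonneg.2 (hA.coeff_nonpos hα h)
  · exact le_rfl

variable {ρ : ℝ} {x : Fin n → ℝ}

theorem IsLMatrix.comparison_summand_nonneg (hA : IsLMatrix A)
    (hα : ∀ i j : Fin n, i < j → 0 ≤ α i j) (hγ0 : 0 ≤ γ) (hx0 : ∀ i, 0 < x i) (i j : Fin n) :
    0 ≤ (aorM A γ i j - aorM (precondMatrix A α) γ i j) * x j :=
  mul_nonneg (sub_nonneg.2 (hA.aorM_precond_le hα hγ0 i j)) (hx0 j).le

theorem IsLMatrix.comparison_summand_nonneg' (hA : IsLMatrix A)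
    (hα : ∀ i j : Fin n, i < j → 0 ≤ α i j) (hγ1 : γ ≤ 1) (hρ : 0 < ρ)
    (hx0 : ∀ i, 0 < x i) (i k : Fin n) :
    0 ≤ upperQ A α i k * (ρ⁻¹ * (aorN A γ *ᵥ x) k) :=
  mul_nonneg (hA.upperQ_nonneg hα i k) (mul_nonneg (inv_nonneg.2 hρ.le)
    (mulVec_nonneg (hA.aorN_nonneg hγ1) (fun i => (hx0 i).le) k))

theorem IsLMatrix.comparisonVec_nonneg (hA : IsLMatrix A)
    (hα : ∀ i j : Fin n, i < j → 0 ≤ α i j) (hγ0 : 0 ≤ γ) (hγ1 : γ ≤ 1) (hρ : 0 < ρ)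
    (hx : aorN A γ *ᵥ x = ρ • (aorM A γ *ᵥ x)) (hx0 : ∀ i, 0 < x i) :
    0 ≤ comparisonVec A α γ x := by
  intro i
  rw [comparisonVec_apply hρ hx]
  exact add_nonneg (Finset.sum_nonneg fun j _ => hA.comparison_summand_nonneg hα hγ0 hx0 i j)
    (Finset.sum_nonneg fun k _ => hA.comparison_summand_nonneg' hα hγ1 hρ hx0 i k)

/-- Positivity coming from the strictly upper triangular part `Q N` of the comparison. -/
theorem IsLMatrix.comparisonVec_pos_of_aorN (hA : IsLMatrix A)
    (hα : ∀ i j : Fin n, i < j → 0 ≤ α i j) (hγ0 : 0 ≤ γ) (hγ1 : γ ≤ 1) (hρ : 0 < ρ)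
    (hx : aorN A γ *ᵥ x = ρ • (aorM A γ *ᵥ x)) (hx0 : ∀ i, 0 < x i) {i j k : Fin n}
    (hik : i < k) (hk : α i k * A i k < 0) (hkj : 0 < aorN A γ k j) :
    0 < comparisonVec A α γ x i := by
  rw [comparisonVec_apply hρ hx]
  refine add_pos_of_nonneg_of_pos
    (Finset.sum_nonneg fun j _ => hA.comparison_summand_nonneg hα hγ0 hx0 i j)
    (Finset.sum_pos' (fun k _ => hA.comparison_summand_nonneg' hα hγ1 hρ hx0 i k)
      ⟨k, Finset.mem_univ k, mul_pos ?_ (mul_pos (inv_pos.2 hρ) ?_)⟩)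
  · simpa [upperQ, hik] using hk
  · change 0 < ∑ j, aorN A γ k j * x j
    exact Finset.sum_pos' (fun j _ => mul_nonneg (hA.aorN_nonneg hγ1 k j) (hx0 j).le)
      ⟨j, Finset.mem_univ j, mul_pos hkj (hx0 j)⟩

/-- Positivity coming from the lower triangular part `M - M'` of the comparison. -/
theorem IsLMatrix.comparisonVec_pos_of_le (hA : IsLMatrix A)
    (hα : ∀ i j : Fin n, i < j → 0 ≤ α i j) (hγ0 : 0 < γ) (hγ1 : γ ≤ 1) (hρ : 0 < ρ)
    (hx : aorN A γ *ᵥ x = ρ • (aorM A γ *ᵥ x)) (hx0 : ∀ i, 0 < x i) {i j k : Fin n}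
    (hji : j ≤ i) (hik : i < k) (hpos : 0 < α i k * A i k * A k j) :
    0 < comparisonVec A α γ x i := by
  rw [comparisonVec_apply hρ hx]
  refine add_pos_of_pos_of_nonneg
    (Finset.sum_pos' (fun j _ => hA.comparison_summand_nonneg hα hγ0.le hx0 i j)
      ⟨j, Finset.mem_univ j, mul_pos (sub_pos.2 ?_) (hx0 j)⟩)
    (Finset.sum_nonneg fun k _ => hA.comparison_summand_nonneg' hα hγ1 hρ hx0 i k)
  have hlt : precondMatrix A α i j < A i j := by
    rw [precondMatrix_apply]
    refine sub_lt_self _ (Finset.sum_pos' (fun l hl => ?_) ⟨k, Finset.mem_Ioi.2 hik, hpos⟩)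
    rw [Finset.mem_Ioi] at hl
    exact hA.term_nonneg hα hl (hji.trans_lt hl).ne'
  rcases hji.lt_or_eq with h | rfl
  · rw [aorM_of_lt _ h, aorM_of_lt _ h]
    exact mul_lt_mul_of_pos_left hlt hγ0
  · rwa [aorM_diag, aorM_diag]

/-- For `γ < 1`, `N` keeps all off-diagonal nonzeros of `A`, so irreducibility gives it a positive
entry in row `k`. -/
theorem IsLMatrix.comparisonVec_pos_of_lt_one (hA : IsLMatrix A) (hirr : IsIrreducible A)
    (hn : 1 < n) (hα : ∀ i j : Fin n, i < j → 0 ≤ α i j) (hγ0 : 0 ≤ γ) (hγ1 : γ < 1) (hρ : 0 < ρ)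
    (hx : aorN A γ *ᵥ x = ρ • (aorM A γ *ᵥ x)) (hx0 : ∀ i, 0 < x i) {i k : Fin n}
    (hik : i < k) (hk : α i k * A i k < 0) : 0 < comparisonVec A α γ x i := by
  obtain ⟨j, hj, hne⟩ := hirr.exists_ne_zero hn k
  have hlt := lt_of_le_of_ne (hA.1 k j hj.symm) hne
  refine hA.comparisonVec_pos_of_aorN hα hγ0 hγ1.le hρ hx hx0 hik hk (j := j) ?_
  rcases lt_or_gt_of_ne hj with h | h
  · rw [aorN_of_lt _ h]
    exact neg_pos.2 (mul_neg_of_pos_of_neg (sub_pos.2 hγ1) hlt)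
  · rw [aorN_of_gt _ h]
    exact neg_pos.2 hlt

theorem IsLMatrix.comparisonVec_pos_of_lt (hA : IsLMatrix A)
    (hα : ∀ i j : Fin n, i < j → 0 ≤ α i j) (hγ0 : 0 ≤ γ) (hγ1 : γ ≤ 1) (hρ : 0 < ρ)
    (hx : aorN A γ *ᵥ x = ρ • (aorM A γ *ᵥ x)) (hx0 : ∀ i, 0 < x i) {i j k : Fin n}
    (hik : i < k) (hkj : k < j) (hpos : 0 < α i k * A i k * A k j) :
    0 < comparisonVec A α γ x i := by
  have h1 := hA.coeff_nonpos hα hik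
  have h2 := hA.1 k j hkj.ne
  have h3 : α i k * A i k < 0 := lt_of_le_of_ne h1 fun h => by simp [h] at hpos
  have h4 : A k j < 0 := lt_of_le_of_ne h2 fun h => by simp [h] at hpos
  exact hA.comparisonVec_pos_of_aorN hα hγ0 hγ1 hρ hx hx0 hik h3
    (by rw [aorN_of_gt _ hkj]; exact neg_pos.2 h4)

/-- As `l = i + 1`, each off-diagonal column `j` of row `l` has `j ≤ i` or `j > l`. No gap is left
between the two positivity criteria. -/
theorem IsLMatrix.comparisonVec_pos_of_succ (hA : IsLMatrix A) (hirr : IsIrreducible A)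
    (hn : 1 < n) (hα : ∀ i j : Fin n, i < j → 0 ≤ α i j) (hγ0 : 0 < γ) (hγ1 : γ ≤ 1) (hρ : 0 < ρ)
    (hx : aorN A γ *ᵥ x = ρ • (aorM A γ *ᵥ x)) (hx0 : ∀ i, 0 < x i) {i l : Fin n}
    (hl : (l : ℕ) = i + 1) (hil : A i l < 0) (hαl : 0 < α i l) :
    0 < comparisonVec A α γ x i := by
  have hlt : i < l := Fin.lt_def.2 (by omega)
  obtain ⟨j, hj, hne⟩ := hirr.exists_ne_zero hn l
  have hpos : 0 < α i l * A i l * A l j := mul_pos_of_neg_of_neg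
    (mul_neg_of_pos_of_neg hαl hil) (lt_of_le_of_ne (hA.1 l j hj.symm) hne)
  rcases lt_or_gt_of_ne hj with h | h
  · exact hA.comparisonVec_pos_of_le hα hγ0 hγ1 hρ hx hx0
      (Fin.le_def.2 (by have := Fin.lt_def.1 h; omega)) hlt hpos
  · exact hA.comparisonVec_pos_of_lt hα hγ0.le hγ1 hρ hx hx0 hlt h hpos

end Precond

/-! ### From the identity to the trichotomy. -/

theorem strictTrichotomy_of_affine {ω ρ ρ' : ℝ} (hω0 : 0 < ω) (hω1 : ω ≤ 1) (hρ : 0 < ρ)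
    (h : (ρ' < ρ ∧ ρ < 1) ∨ (ρ' = ρ ∧ ρ = 1) ∨ (ρ' > ρ ∧ ρ > 1)) :
    StrictTrichotomy (ENNReal.ofReal (1 - ω + ω * ρ')) (ENNReal.ofReal (1 - ω + ω * ρ)) := by
  have hpos : ∀ {t : ℝ}, 0 < t → 0 < 1 - ω + ω * t := fun ht => by
    have := mul_pos hω0 ht
    linarith
  have hlt : ∀ {s t : ℝ}, 0 < t → s < t →
      ENNReal.ofReal (1 - ω + ω * s) < ENNReal.ofReal (1 - ω + ω * t) := fun ht hst =>
    (ENNReal.ofReal_lt_ofReal_iff (hpos ht)).2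
      (by linarith [mul_lt_mul_of_pos_left hst hω0])
  have hone : ENNReal.ofReal (1 - ω + ω * 1) = 1 := by simp
  refine ⟨?_, ?_, ?_, ?_⟩
  · rcases h with ⟨h1, h2⟩ | ⟨h1, h2⟩ | ⟨h1, h2⟩
    · exact Or.inl ⟨hlt hρ h1, hone ▸ hlt one_pos h2⟩
    · subst h1 h2
      exact Or.inr (Or.inl ⟨rfl, hone⟩)
    · exact Or.inr (Or.inr ⟨hlt (hρ.trans h1) h1, hone ▸ hlt hρ h2⟩)
  · rintro ⟨⟨_, h1⟩, _, h2⟩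
    exact h1.ne h2
  · rintro ⟨⟨_, h1⟩, _, h2⟩
    exact h1.not_gt h2
  · rintro ⟨⟨_, h1⟩, _, h2⟩
    exact h2.ne' h1

/-- The case `ρ' = 0` is harmless: for `ρ < 1` it gives `ρ' < ρ` at once, and `ρ > 1` rules it out
since `d ≥ 0` already yields `ρ' ≥ ρ`. -/
theorem trichotomy_of_identity {ρ ρ' c d : ℝ} (hρ : 0 < ρ) (hc : 0 < c) (hd : 0 ≤ d)
    (hρ' : 0 ≤ ρ') (hpos : 0 < ρ' → 0 < d) (h : (ρ' - ρ) * c = (ρ - 1) * d) :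
    (ρ' < ρ ∧ ρ < 1) ∨ (ρ' = ρ ∧ ρ = 1) ∨ (ρ' > ρ ∧ ρ > 1) := by
  have hge : 1 ≤ ρ → ρ ≤ ρ' := fun h1 =>
    sub_nonneg.1 (nonneg_of_mul_nonneg_left (h ▸ mul_nonneg (sub_nonneg.2 h1) hd) hc)
  rcases lt_trichotomy ρ 1 with h1 | h1 | h1
  · refine Or.inl ⟨?_, h1⟩
    rcases hρ'.lt_or_eq with h2 | h2
    · have h3 := mul_neg_of_neg_of_pos (sub_neg.2 h1) (hpos h2)
      rw [← h] at h3
      exact sub_neg.1 (neg_of_mul_neg_left h3 hc.le)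
    · rwa [← h2]
  · refine Or.inr (Or.inl ⟨?_, h1⟩)
    rw [h1, sub_self, zero_mul] at h
    rw [h1]
    exact sub_eq_zero.1 ((mul_eq_zero.1 h).resolve_right hc.ne')
  · refine Or.inr (Or.inr ⟨?_, h1⟩)
    have h3 := mul_pos (sub_pos.2 h1) (hpos (hρ.trans_le (hge h1.le)))
    rw [← h] at h3
    exact sub_pos.1 (pos_of_mul_pos_left h3 hc.le)

theorem dotProduct_pos_of_pos {n : ℕ} {v z : Fin n → ℝ} (hv : 0 ≤ v) (hz : 0 ≤ z) {i : Fin n}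
    (hvi : 0 < v i) (hzi : 0 < z i) : 0 < v ⬝ᵥ z :=
  Finset.sum_pos' (fun k _ => mul_nonneg (hv k) (hz k)) ⟨i, Finset.mem_univ i, mul_pos hvi hzi⟩

/-- A left Perron vector of the pencil with a nonzero root is not supported on the last index. -/
theorem exists_pos_of_left_perron {n : ℕ} {B : Matrix (Fin n) (Fin n) ℝ} {γ ρ : ℝ}
    (hB : IsLMatrix B) (hρ : 0 < ρ) {v : Fin n → ℝ} (hv : 0 ≤ v) (hv0 : v ≠ 0)
    (h : v ᵥ* aorN B γ = ρ • (v ᵥ* aorM B γ)) : ∃ i : Fin n, (i : ℕ) + 1 < n ∧ 0 < v i := by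
  by_contra! hcon
  have hz : ∀ i : Fin n, (i : ℕ) + 1 < n → v i = 0 := fun i hi => le_antisymm (hcon i hi) (hv i)
  obtain ⟨p, hp⟩ := Function.ne_iff.1 hv0
  have hpn : (p : ℕ) + 1 = n := by
    by_contra hne
    exact hp (hz p (by omega))
  have hother : ∀ i, i ≠ p → v i = 0 := fun i hi => hz i (by
    have := Fin.val_ne_of_ne hi
    omega)
  -- At column `p` only the diagonal entries meet `v`: that of `N` is zero, that of `M` positive.
  have h1 := congrFun h p
  simp only [vecMul, dotProduct, Pi.smul_apply, smul_eq_mul] at h1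
  rw [Finset.sum_eq_single p (fun i _ hi => by rw [hother i hi, zero_mul]) (by simp),
    Finset.sum_eq_single p (fun i _ hi => by rw [hother i hi, zero_mul]) (by simp),
    aorN_diag, aorM_diag, mul_zero] at h1
  exact mul_ne_zero hρ.ne' (mul_ne_zero hp (hB.2 p).ne') h1.symm

end PrecondAOR

/-! ### The main theorem. -/

open PrecondAOR Matrix

theorem theorem3p47 (n : ℕ) (A : Matrix (Fin n) (Fin n) ℝ) (α : Fin n → Fin n → ℝ) (γ ω : ℝ)
    (hω0 : 0 < ω) (hω1 : ω ≤ 1) (hγ0 : 0 ≤ γ) (hγ1 : γ ≤ 1)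
    -- `A` is an irreducible L-matrix with unit diagonal
    (hA : PrecondAOR.IsLMatrix A) (hirr : PrecondAOR.IsIrreducible A) (hdiag : ∀ i, A i i = 1)
    -- standing assumptions on the parameters of the preconditioner
    (hα : ∀ i j : Fin n, i < j → 0 ≤ α i j)
    (hQ : ∑ i : Fin n, ∑ j ∈ Finset.Ioi i, α i j * A i j ≠ 0)
    (hsum : ∀ i : Fin n, (i : ℕ) + 1 < n → ∑ k ∈ Finset.Ioi i, α i k * A i k * A k i < 1)
    (hcond :
      -- (i)
      (γ < 1 ∧ PrecondAOR.LesssimCond A α) ∨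
      -- (ii)
      (γ = 1 ∧ PrecondAOR.LesssimCond A α ∧
        ((∃ i j k : Fin n, j ≤ i ∧ i < k ∧ 0 < α i k * A i k * A k j) ∨
         (∃ i j k : Fin n, i < k ∧ k < j ∧ 0 < α i k * A i k * A k j) ∨
         (∃ k l : Fin n, (l : ℕ) = k + 1 ∧ A k l < 0 ∧ 0 < α k l) ∨
         ((∃ p q : Fin n, (p : ℕ) + 1 = n ∧ (q : ℕ) = 0 ∧ A p q < 0) ∧
           ∀ k l : Fin n, (l : ℕ) = k + 1 → A k l < 0) ∨
         ((∃ p q : Fin n, (p : ℕ) + 1 = n ∧ (q : ℕ) = 0 ∧ A p q < 0) ∧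
           ∀ k p : Fin n, 1 ≤ (k : ℕ) → (k : ℕ) + 1 < n → (p : ℕ) + 1 = n → A k p < 0) ∨
         (∀ k q : Fin n, 1 ≤ (k : ℕ) → (q : ℕ) = 0 → A k q < 0))) ∨
      -- (iii)
      (γ < 1 ∧ PrecondAOR.WeakCond A α ∧
        ∀ i : Fin n, (i : ℕ) + 1 < n → ∃ j : Fin n, i < j ∧ α i j * A i j < 0) ∨
      -- (iv)
      (γ = 1 ∧ PrecondAOR.WeakCond A α ∧
        ∀ i : Fin n, (i : ℕ) + 1 < n →
          ((∃ j k : Fin n, j ≤ i ∧ i < k ∧ 0 < α i k * A i k * A k j) ∨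
           (∃ j k : Fin n, i < k ∧ k < j ∧ 0 < α i k * A i k * A k j) ∨
           (∃ l : Fin n, (l : ℕ) = i + 1 ∧ A i l < 0 ∧ 0 < α i l)))) :
    PrecondAOR.StrictTrichotomy
      (PrecondAOR.specRadius (PrecondAOR.aorMatrix (PrecondAOR.precondMatrix A α) γ ω))
      (PrecondAOR.specRadius (PrecondAOR.aorMatrix A γ ω)) := by
  -- A nonzero entry of `Q` forces `n > 1` and seeds the strictness argument in cases (i) and
  -- (ii₄)–(ii₆).
  obtain ⟨i₀, k₀, hik₀, hQ₀⟩ : ∃ i k : Fin n, i < k ∧ α i k * A i k < 0 := by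
    by_contra! hcon
    refine hQ (Finset.sum_eq_zero fun i _ => Finset.sum_eq_zero fun j hj => ?_)
    rw [Finset.mem_Ioi] at hj
    exact le_antisymm (hA.coeff_nonpos hα hj) (hcon i j hj)
  have hn : 1 < n := by
    have h1 := Fin.lt_def.1 hik₀
    have h2 := k₀.isLt
    omega
  have : Nonempty (Fin n) := ⟨i₀⟩
  have hW : WeakCond A α := by
    rcases hcond with ⟨_, h⟩ | ⟨_, h, _⟩ | ⟨_, h, _⟩ | ⟨_, h, _⟩
    · exact h.weakCond hA hα
    · exact h.weakCond hA hα
    · exact h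
    · exact h
  have hB := hA.precond hdiag hα hsum hW
  obtain ⟨ρ, -, hr, ⟨x, hx, hx0, hNx⟩, v₀, -, -, hv₀, hv₀0, hNv₀⟩ :=
    hA.exists_perron hω0 hω1 hγ0 hγ1
  obtain ⟨ρ', hρ', hr', -, v, hv, hv0, hvM, hvM0, hNv⟩ := hB.exists_perron hω0 hω1 hγ0 hγ1
  have hρ : 0 < ρ := hA.perron_root_pos hirr hn hγ0 hγ1 hv₀ hv₀0 hNv₀
  have hxpos := hA.right_perron_pos hirr hγ0 hγ1 hρ hx hx0 hNx
  have hz := hA.comparisonVec_nonneg hα hγ0 hγ1 hρ hNx hxpos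
  rw [hr, hr']
  refine strictTrichotomy_of_affine hω0 hω1 hρ (trichotomy_of_identity hρ ?_
    (dotProduct_nonneg_of_nonneg hv hz) hρ' (fun hρ'0 => ?_) (comparison_identity hNx hNv))
  · obtain ⟨j, hj⟩ := Function.ne_iff.1 hvM0
    exact dotProduct_pos_of_pos hvM hx (lt_of_le_of_ne (hvM j) (Ne.symm hj)) (hxpos j)
  have hstrong : LesssimCond A α → (∃ i, 0 < comparisonVec A α γ x i) →
      0 < v ⬝ᵥ comparisonVec A α γ x := by
    rintro hS ⟨i, hi⟩
    exact dotProduct_pos_of_pos hv hz (hB.left_perron_pos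
      (hS.isIrreducible hA hirr hdiag hα) hγ0 hγ1 hρ'0 hv hv0 hNv i) hi
  have hweak : (∀ i : Fin n, (i : ℕ) + 1 < n → 0 < comparisonVec A α γ x i) →
      0 < v ⬝ᵥ comparisonVec A α γ x := by
    intro h
    obtain ⟨i, hi, hvi⟩ := exists_pos_of_left_perron hB hρ'0 hv hv0 hNv
    exact dotProduct_pos_of_pos hv hz hvi (h i hi)
  rcases hcond with ⟨hγ, hS⟩ | ⟨hγ, hS, hc⟩ | ⟨hγ, -, hc⟩ | ⟨hγ, -, hc⟩
  · exact hstrong hS ⟨i₀, hA.comparisonVec_pos_of_lt_one hirr hn hα hγ0 hγ hρ hNx hxpos hik₀ hQ₀⟩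
  · have hγ0' : 0 < γ := hγ ▸ one_pos
    have hle : ∀ {i j k : Fin n}, j ≤ i → i < k → 0 < α i k * A i k * A k j →
        0 < v ⬝ᵥ comparisonVec A α γ x := fun h1 h2 h3 =>
      hstrong hS ⟨_, hA.comparisonVec_pos_of_le hα hγ0' hγ1 hρ hNx hxpos h1 h2 h3⟩
    have hlt : ∀ {i j k : Fin n}, i < k → k < j → 0 < α i k * A i k * A k j →
        0 < v ⬝ᵥ comparisonVec A α γ x := fun h1 h2 h3 =>
      hstrong hS ⟨_, hA.comparisonVec_pos_of_lt hα hγ0 hγ1 hρ hNx hxpos h1 h2 h3⟩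
    have hik₀' := Fin.lt_def.1 hik₀
    have hk₀n := k₀.isLt
    rcases hc with ⟨i, j, k, h1, h2, h3⟩ | ⟨i, j, k, h1, h2, h3⟩ | ⟨k, l, h1, h2, h3⟩ |
      ⟨⟨p, q, hp, hq, hpq⟩, h⟩ | ⟨⟨p, q, hp, hq, hpq⟩, h⟩ | h
    · exact hle h1 h2 h3
    · exact hlt h1 h2 h3
    · exact hstrong hS ⟨k,
        hA.comparisonVec_pos_of_succ hirr hn hα hγ0' hγ1 hρ hNx hxpos h1 h2 h3⟩
    -- Row `k₀` needs a negative entry to the right of `k₀` or in a column up to `i₀`: the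
    -- superdiagonal gives the former, and when `k₀` is last the corner `a_{n,1}` gives the latter.
    · by_cases hk : (k₀ : ℕ) + 1 < n
      · exact hlt (j := ⟨k₀ + 1, hk⟩) hik₀ (Fin.lt_def.2 (Nat.lt_succ_self _))
          (mul_pos_of_neg_of_neg hQ₀ (h _ _ rfl))
      · obtain rfl : k₀ = p := Fin.ext (by omega)
        exact hle (Fin.le_def.2 (by omega)) hik₀ (mul_pos_of_neg_of_neg hQ₀ hpq)
    · by_cases hk : (k₀ : ℕ) + 1 < n
      · exact hlt (j := p) hik₀ (Fin.lt_def.2 (by omega))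
          (mul_pos_of_neg_of_neg hQ₀ (h _ _ (by omega) hk hp))
      · obtain rfl : k₀ = p := Fin.ext (by omega)
        exact hle (Fin.le_def.2 (by omega)) hik₀ (mul_pos_of_neg_of_neg hQ₀ hpq)
    · exact hle (j := ⟨0, by omega⟩) (Fin.le_def.2 (Nat.zero_le _)) hik₀
        (mul_pos_of_neg_of_neg hQ₀ (h _ _ (by omega) rfl))
  · refine hweak fun i hi => ?_
    obtain ⟨j, hij, hj⟩ := hc i hi
    exact hA.comparisonVec_pos_of_lt_one hirr hn hα hγ0 hγ hρ hNx hxpos hij hj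
  · have hγ0' : 0 < γ := hγ ▸ one_pos
    refine hweak fun i hi => ?_
    rcases hc i hi with ⟨j, k, h1, h2, h3⟩ | ⟨j, k, h1, h2, h3⟩ | ⟨l, h1, h2, h3⟩
    · exact hA.comparisonVec_pos_of_le hα hγ0' hγ1 hρ hNx hxpos h1 h2 h3
    · exact hA.comparisonVec_pos_of_lt hα hγ0 hγ1 hρ hNx hxpos h1 h2 h3
    · exact hA.comparisonVec_pos_of_succ hirr hn hα hγ0' hγ1 hρ hNx hxpos h1 h2 h3
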